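/- Let $d,n\in\mathbb{N}$, $m\in\{1,\dots,n\}$, $\alpha\in(0,1)$, $\tau\in\mathbb{R}$ and $\sigma>0$. For $x,x'\in\mathbb{R}^d$ write $x\preccurlyeq x'$ if $x$ is coordinatewise at most $x'$. Let $P$ be a probability distribution on $\mathbb{R}^d\times\mathbb{R}$ such that, for $(X,Y)\sim P$, the regression function $\eta(x)=\mathbb{E}(Y\mid X=x)$ is (Borel and) coordinatewise increasing, i.e. $\eta(x)\le\eta(x')$ whenever $x\preccurlyeq x'$, and the conditional distribution of $Y-\eta(X)$ given $X$ is sub-Gaussian with variance parameter $\sigma^2$, i.e. almost surely $\mathbb{E}(e^{t(Y-\eta(X))}\mid X)\le e^{\sigma^2t^2/2}$ for every $t\in\mathbb{R}$. Let $\mathcal{D}=((X_1,Y_1),\dots,(X_n,Y_n))\sim P^n$ and $\mathcal{D}_X=(X_1,\dots,X_n)$. *$p$-values.* For $x\in\mathbb{R}^d$ let $n(x)$ be the number of $i\in\{1,\dots,n\}$ with $X_i\preccurlyeq x$, and let $Y_{(1)}(x),\dots,Y_{(n(x))}(x)$ be the responses belonging to these $X_i$, arranged in increasing order of the supremum-norm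 distance $\|X_i-x\|_\infty$ (ties broken by the order of the indices). With $S_k=\sum_{j=1}^k (Y_{(j)}(x)-\tau)/\sigma$, put $$\hat p(x)=1\wedge\min_{1\le k\le n(x)}5.2\exp\Bigl\{-\frac{(S_k\vee0)^2}{2.0808\,k}+\frac{\log\log(2k)}{0.72}\Bigr\}$$ if $n(x)>0$, and $\hat p(x)=1$ otherwise. *Graphs.* Let $G$ be the directed acyclic graph on $\{1,\dots,m\}$ with an edge from $i_0$ to $i_1$ if and only if $i_0\ne i_1$, $X_{i_1}\preccurlyeq X_{i_0}$, $i_1<i_0$ in case $X_{i_1}=X_{i_0}$, and every $i_2\in\{1,\dots,m\}$ with $X_{i_1}\preccurlyeq X_{i_2}\preccurlyeq X_{i_0}$ satisfies either $X_{i_2}=X_{i_0}$ and $i_0\le i_2$, or $X_{i_2}=X_{i_1}$ and $i_2\le i_1$. Let $F$ be the subgraph of $G$ that retains, among the edges of $G$ into a vertex $i_1$, only the one from the parent $i_0$ with the smallest $\|X_{i_0}-X_{i_1}\|_\infty$ (the smallest such index in case of ties). *Rejections.* Let $R_0=\emptyset$. For $\ell=1,\dots,m$, let $S_{\mathrm L}$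 be the set of vertices outside $R_{\ell-1}$ that have no children in $F$, and let $S_{\mathrm C}$ be the set of vertices outside $R_{\ell-1}$ whose parents in $F$ all lie in $R_{\ell-1}$. For $i\in S_{\mathrm C}$ let $\alpha_i=\alpha\,|(\{i\}\cup\mathrm{de}_F(i))\cap S_{\mathrm L}|/|S_{\mathrm L}|$, where $\mathrm{de}_F(i)$ is the set of descendants of $i$ in $F$, and let $\alpha_i=0$ for $i\notin S_{\mathrm C}$. Let $R_\ell$ be the union of $R_{\ell-1}$, of $I_\ell=\{i:\hat p(X_i)\le\alpha_i\}$ and of the set of all ancestors in $G$ of elements of $I_\ell$. The isotonic subgroup selection (ISS) set is $$\hat A^{\mathrm{ISS}}_{\sigma,\tau,\alpha,m}(\mathcal{D})=\{x\in\mathbb{R}^d: X_i\preccurlyeq x\text{ for some }i\in R_m\}.$$ Then, almost surely, $$\mathbb{P}_P\bigl(\hat A^{\mathrm{ISS}}_{\sigma,\tau,\alpha,m}(\mathcal{D})\subseteq\{x\in\mathbb{R}^d:\eta(x)\ge\tau\}\bigm|\mathcal{D}_X\bigr)\ge1-\alpha .$$ -/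

import Mathlib

open MeasureTheory ProbabilityTheory
open scoped NNReal

namespace ISS

/-! ### The distributional class

`Fin d → ℝ` carries the coordinatewise order and the supremum norm. -/

/-- `η` is a (Borel) version of the regression function `x ↦ E(Y | X = x)` when `(X, Y) ∼ P`:
for almost every `x`, the conditional law of `Y` given `X = x` has mean `η x`.
(`Y` itself is not required to be integrable, only its conditional laws.) -/
structure IsRegressionFunction {d : ℕ} (P : Measure ((Fin d → ℝ) × ℝ)) [IsProbabilityMeasure P]
    (η : (Fin d → ℝ) → ℝ) : Prop where
  measurable : Measurable η
  integrable : ∀ᵐ x ∂P.fst, Integrable (fun y : ℝ => y) (P.condKernel x)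
  eq_integral : ∀ᵐ x ∂P.fst, η x = ∫ y, y ∂(P.condKernel x)

/-- `P` has the coordinatewise increasing regression function `η`, and the conditional law of
`Y - η(X)` given `X` is sub-Gaussian with variance parameter `σ ^ 2`. -/
structure IsMonotoneSubGaussian {d : ℕ} (σ : ℝ) (P : Measure ((Fin d → ℝ) × ℝ))
    [IsProbabilityMeasure P] (η : (Fin d → ℝ) → ℝ) : Prop where
  regression : IsRegressionFunction P η
  monotone : Monotone η
  subGaussian : ∀ᵐ x ∂P.fst,
    HasSubgaussianMGF (fun y : ℝ => y - η x) (⟨σ ^ 2, sq_nonneg σ⟩ : ℝ≥0) (P.condKernel x)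

/-- The `τ`-superlevel set of `f`. -/
def superlevelSet {d : ℕ} (τ : ℝ) (f : (Fin d → ℝ) → ℝ) : Set (Fin d → ℝ) :=
  {x | τ ≤ f x}

/-! ### The p-values -/

/-- The covariates `(X₁, …, Xₙ)` of a data set `((X₁, Y₁), …, (Xₙ, Yₙ))`. -/
def covariates {n d : ℕ} (D : Fin n → (Fin d → ℝ) × ℝ) : Fin n → Fin d → ℝ :=
  fun i => (D i).1

open Classical in
/-- The indices `i` with `X i ≤ x` coordinatewise. -/
noncomputable def lowerIdx {n d : ℕ} (X : Fin n → Fin d → ℝ) (x : Fin d → ℝ) :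
    Finset (Fin n) :=
  Finset.univ.filter fun i => X i ≤ x

open Classical in
/-- For an index `i` with `X i ≤ x`, the number `j ≥ 1` such that `X i` is the `j`-th nearest
neighbour of `x` in supremum norm among the `X l` with `X l ≤ x`, ties being broken by retaining
the order of the indices. -/
noncomputable def neighbourRank {n d : ℕ} (X : Fin n → Fin d → ℝ) (x : Fin d → ℝ)
    (i : Fin n) : ℕ :=
  ((lowerIdx X x).filter fun l =>
    ‖X l - x‖ < ‖X i - x‖ ∨ (‖X l - x‖ = ‖X i - x‖ ∧ l ≤ i)).card

/-- `S_k`, the sum of `(Y - τ) / σ` over the responses attached to the `k` nearest neighbours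
of `x` among the covariates that lie below `x`. -/
noncomputable def partialSum {n d : ℕ} (σ τ : ℝ) (D : Fin n → (Fin d → ℝ) × ℝ)
    (x : Fin d → ℝ) (k : ℕ) : ℝ :=
  ∑ i ∈ (lowerIdx (covariates D) x).filter (fun i => neighbourRank (covariates D) x i ≤ k),
    ((D i).2 - τ) / σ

open Classical in
/-- The p-value at `x`; the minimum runs over `1 ≤ k ≤ n(x)`, with `n(x)` the number of
covariates below `x`, and the p-value is `1` if there are none. -/
noncomputable def pValue {n d : ℕ} (σ τ : ℝ) (D : Fin n → (Fin d → ℝ) × ℝ)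
    (x : Fin d → ℝ) : ℝ :=
  if h : (Finset.Icc 1 (lowerIdx (covariates D) x).card).Nonempty then
    min 1 ((Finset.Icc 1 (lowerIdx (covariates D) x).card).inf' h fun k =>
      5.2 * Real.exp (-(max (partialSum σ τ D x k) 0) ^ 2 / (2.0808 * (k : ℝ))
        + Real.log (Real.log (2 * (k : ℝ))) / 0.72))
  else 1

/-! ### Weighted directed acyclic graphs and the multiple testing procedure -/

/-- A directed acyclic graph with nonnegative edge weights in which every vertex has at most one
parent along an edge of positive weight. (Weights off the edge set play no role.) -/
structure PolyforestWeightedDAG (I : Type*) extends Digraph I where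
  weight : I → I → ℝ≥0
  acyclic : ∀ i, ¬ Relation.TransGen Adj i i
  polyforest : ∀ i j k, Adj j i → 0 < weight j i → Adj k i → 0 < weight k i → j = k

namespace PolyforestWeightedDAG

variable {I : Type*}

/-- The edges of weight one. -/
def FAdj (G : PolyforestWeightedDAG I) (i j : I) : Prop :=
  G.Adj i j ∧ G.weight i j = 1

variable [Fintype I]

open Classical in
/-- The unrejected leaves of the polyforest, when `R` is the set of rejected vertices. -/
noncomputable def unrejectedLeaves (G : PolyforestWeightedDAG I) (R : Finset I) : Finset I :=
  Finset.univ.filter fun i => (∀ j, ¬ G.FAdj i j) ∧ i ∉ R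

open Classical in
/-- The rejection candidates: unrejected vertices all of whose polyforest parents have been
rejected. -/
noncomputable def candidates (G : PolyforestWeightedDAG I) (R : Finset I) : Finset I :=
  Finset.univ.filter fun i => i ∉ R ∧ ∀ j, G.FAdj j i → j ∈ R

open Classical in
/-- The budget of vertex `i`: a candidate receives the share of `α` given by the proportion of
unrejected leaves that are equal to `i` or descend from `i` in the polyforest. -/
noncomputable def budget (G : PolyforestWeightedDAG I) (α : ℝ) (R : Finset I) (i : I) : ℝ :=
  if i ∈ G.candidates R then
    (((G.unrejectedLeaves R).filter
      fun j => j = i ∨ Relation.TransGen G.FAdj i j).card : ℝ) * α / (G.unrejectedLeaves R).card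
  else 0

open Classical in
/-- The vertices whose p-value does not exceed their budget. -/
noncomputable def newRejections (G : PolyforestWeightedDAG I) (α : ℝ) (p : I → ℝ)
    (R : Finset I) : Finset I :=
  Finset.univ.filter fun i => p i ≤ G.budget α R i

open Classical in
/-- One iteration: reject the new rejections and all their ancestors in the graph. -/
noncomputable def step (G : PolyforestWeightedDAG I) (α : ℝ) (p : I → ℝ)
    (R : Finset I) : Finset I :=
  R ∪ G.newRejections α p R ∪
    Finset.univ.filter fun j => ∃ i ∈ G.newRejections α p R, Relation.TransGen G.Adj j i

/-- The set of vertices rejected after `|I|` iterations started from the empty set. Stopping early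
when nothing new is rejected, or when everything is, would give the same set, as `step` then
leaves it unchanged. -/
noncomputable def rejectedSet (G : PolyforestWeightedDAG I) (α : ℝ) (p : I → ℝ) : Finset I :=
  (G.step α p)^[Fintype.card I] ∅

end PolyforestWeightedDAG

/-! ### The graph induced by a finite family of points -/

section Induced

variable {m d : ℕ}

/-- Edges of the induced DAG: there is an edge from `i₀` to `i₁` if `i₁` is an immediate
predecessor of `i₀` in the partial order obtained from the coordinatewise order on the points,
where equal points are ordered by their indices. -/
def InducedEdge (z : Fin m → Fin d → ℝ) (i₀ i₁ : Fin m) : Prop :=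
  i₀ ≠ i₁ ∧ z i₁ ≤ z i₀ ∧ (z i₁ = z i₀ → i₁ < i₀) ∧
    ∀ i₂, z i₁ ≤ z i₂ → z i₂ ≤ z i₀ → (z i₂ = z i₀ ∧ i₀ ≤ i₂) ∨ (z i₂ = z i₁ ∧ i₂ ≤ i₁)

/-- Edges of the induced polyforest: `i₀` is the smallest index among the parents of `i₁` whose
points are closest to that of `i₁` in supremum norm. -/
def InducedForestEdge (z : Fin m → Fin d → ℝ) (i₀ i₁ : Fin m) : Prop :=
  InducedEdge z i₀ i₁ ∧ ∀ i, InducedEdge z i i₁ →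
    ‖z i₀ - z i₁‖ < ‖z i - z i₁‖ ∨ (‖z i₀ - z i₁‖ = ‖z i - z i₁‖ ∧ i₀ ≤ i)

theorem inducedEdge_acyclic (z : Fin m → Fin d → ℝ) (i : Fin m) :
    ¬ Relation.TransGen (InducedEdge z) i i := by
  have key : ∀ j, Relation.TransGen (InducedEdge z) i j →
      z j ≤ z i ∧ (z j = z i → j < i) := by
    intro j h
    induction h with
    | single h => exact ⟨h.2.1, h.2.2.1⟩
    | tail _ h ih =>
      refine ⟨h.2.1.trans ih.1, fun e => ?_⟩
      have e1 := le_antisymm ih.1 (e ▸ h.2.1)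
      exact (h.2.2.1 (e.trans e1.symm)).trans (ih.2 e1)
  exact fun h => lt_irrefl _ ((key i h).2 rfl)

theorem inducedForestEdge_unique (z : Fin m → Fin d → ℝ) (i j k : Fin m)
    (hj : InducedForestEdge z j i) (hk : InducedForestEdge z k i) : j = k := by
  rcases hj.2 k hk.1 with h | h <;> rcases hk.2 j hj.1 with h' | h'
  · exact absurd h h'.not_gt
  · exact absurd h h'.1.le.not_gt
  · exact absurd h' h.1.le.not_gt
  · exact le_antisymm h.2 h'.2

open Classical in
/-- The induced polyforest-weighted DAG: the induced DAG, an edge having weight one if it belongs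
to the induced polyforest and weight zero otherwise. -/
noncomputable def inducedGraph (z : Fin m → Fin d → ℝ) : PolyforestWeightedDAG (Fin m) where
  Adj := InducedEdge z
  weight i j := if InducedForestEdge z i j then 1 else 0
  acyclic := inducedEdge_acyclic z
  polyforest i j k _ hj _ hk := by
    have hj' : InducedForestEdge z j i := by
      by_contra h
      simp [h] at hj
    have hk' : InducedForestEdge z k i := by
      by_contra h
      simp [h] at hk
    exact inducedForestEdge_unique z i j k hj' hk'

end Induced

/-! ### The selection set -/

/-- The indices rejected by the procedure, among the first `m` observations. -/
noncomputable def rejectedIdx {n d m : ℕ} (hm : m ≤ n) (σ τ α : ℝ)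
    (D : Fin n → (Fin d → ℝ) × ℝ) : Finset (Fin m) :=
  (inducedGraph fun i : Fin m => covariates D (Fin.castLE hm i)).rejectedSet α
    fun i => pValue σ τ D (covariates D (Fin.castLE hm i))

/-- The isotonic subgroup selection set: the upper hull of the rejected covariates. -/
def selectionSet {n d m : ℕ} (hm : m ≤ n) (σ τ α : ℝ)
    (D : Fin n → (Fin d → ℝ) × ℝ) : Set (Fin d → ℝ) :=
  {x | ∃ i ∈ rejectedIdx hm σ τ α D, covariates D (Fin.castLE hm i) ≤ x}

end ISS

/-! Given the covariates, the responses are independent with laws `P.condKernel (X i)`. As `η` is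
monotone, the selected set lies in the superlevel set iff every rejected index has `η (X i) ≥ τ`
(`selectionSet_subset_iff`). The claim is thus familywise error control, given the covariates, for
the null hypotheses `η (X i) < τ`.

Null p-values are valid (`measure_pValue_le`). All responses used at a null point have mean at most
`τ`, and their order depends on the covariates only; so `exp (l * S_k - l ^ 2 * k / 2)` is a
nonnegative supermartingale for `l ≥ 0`, and Ville's inequality bounds the probability that `S_k`
ever crosses a line. The curved boundary behind `pValue` lies above a suitable line on each dyadic
epoch of `k`; a union bound over epochs costs a multiple of `∑ (j + 1) ^ (-7/5)`, and the numerical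
constants make the total at most `t`.

The testing step is a sequential rejection argument. The set `T` of false nulls is closed under
ancestors. While only members of `T` are rejected, the budget of a null is at most its budget at `R
= T` (`budget_mono`). A first false rejection therefore forces some null p-value below a budget that
is fixed given the covariates. These budgets sum to at most `α` because distinct candidates have
disjoint sets of leaves below them (`sum_budget_le`), so a union bound suffices, whatever the
dependence between the p-values.

Integrating over covariate events turns this into the bound on the conditional expectation. -/

open scoped ENNReal

/-! ### Numerical bound for the series `∑ (j + 1) ^ (-7/5)` -/

/-- Taking fifth powers reduces a bound on an irrational power to arithmetic with integer powers. -/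
theorem rpow_neg_seven_fifths_le {x q : ℝ} (hx : 0 < x) (hq : 0 < q) (h : 1 ≤ q ^ 5 * x ^ 7) :
    x ^ (-(7 / 5) : ℝ) ≤ q := by
  have h5 : (x ^ (-(7 / 5) : ℝ)) ^ 5 * x ^ 7 = 1 := by
    rw [← Real.rpow_natCast, ← Real.rpow_natCast, ← Real.rpow_mul hx.le, ← Real.rpow_add hx]
    norm_num
  have h7 : 0 < x ^ 7 := by positivity
  have : (x ^ (-(7 / 5) : ℝ)) ^ 5 ≤ q ^ 5 := by
    rw [← h5] at h
    exact le_of_mul_le_mul_right h h7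
  exact le_of_pow_le_pow_left₀ (by norm_num) hq.le this

/-- A discrete form of comparison with `∫ x ^ (-7/5)`, from Bernoulli's inequality with exponent
`2/5`; summed, it telescopes and bounds the tail of the series. -/
theorem rpow_neg_seven_fifths_telescope {x : ℝ} (hx : 0 < x) :
    (x + 1) ^ (-(7 / 5) : ℝ) + 5 / 2 * (x + 1) ^ (-(2 / 5) : ℝ) ≤ 5 / 2 * x ^ (-(2 / 5) : ℝ) := by
  have hx1 : 0 < x + 1 := by linarith
  set y := 1 / (x + 1) with hy
  have hy0 : 0 < y := by positivity
  have hy1 : y < 1 := by rw [hy, div_lt_one hx1]; linarith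
  have hb := rpow_one_add_le_one_add_mul_self (s := -y) (by linarith) (p := 2 / 5)
    (by norm_num) (by norm_num)
  have hxy : 1 + -y = x / (x + 1) := by rw [hy]; field_simp; ring
  rw [hxy, Real.div_rpow hx.le hx1.le] at hb
  have e1 : (x + 1) ^ (-(7 / 5) : ℝ) = (x + 1) ^ (-(2 / 5) : ℝ) * y := by
    rw [hy, one_div, ← Real.rpow_neg_one (x + 1), ← Real.rpow_add hx1]; norm_num
  rw [e1, Real.rpow_neg hx.le, Real.rpow_neg hx1.le]
  have hA : 0 < (x + 1) ^ (2 / 5 : ℝ) := by positivity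
  have hB : 0 < x ^ (2 / 5 : ℝ) := by positivity
  generalize (x + 1) ^ (2 / 5 : ℝ) = A at *
  generalize x ^ (2 / 5 : ℝ) = B at *
  rw [div_le_iff₀ hA] at hb
  have : B * (y + 5 / 2) ≤ 5 / 2 * A := by
    calc B * (y + 5 / 2) ≤ ((1 + 2 / 5 * -y) * A) * (y + 5 / 2) := by gcongr
      -- The terms linear in `y` cancel: `(1 - 2y/5) * (y + 5/2) = 5/2 - 2y²/5`.
      _ ≤ 5 / 2 * A := by nlinarith [sq_nonneg y]
  rw [← sub_nonneg]
  have e : 5 / 2 * B⁻¹ - (A⁻¹ * y + 5 / 2 * A⁻¹) = (5 / 2 * A - B * (y + 5 / 2)) / (A * B) := by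
    field_simp
  rw [e]
  exact div_nonneg (by linarith) (by positivity)

/-- Eight terms are bounded numerically and the rest by the telescoping tail `5/2 * 8 ^ (-2/5)`.
Partial sum plus tail bound is nonincreasing in the cut-off, so the bound at `8` persists. -/
theorem sum_rpow_neg_seven_fifths_le (J : ℕ) :
    ∑ j ∈ Finset.range J, ((j : ℝ) + 1) ^ (-(7 / 5) : ℝ) ≤ 3.14 := by
  have h8 : ∑ j ∈ Finset.range 8, ((j : ℝ) + 1) ^ (-(7 / 5) : ℝ)
      + 5 / 2 * (8 : ℝ) ^ (-(2 / 5) : ℝ) ≤ 3.14 := by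
    have e8 : (8 : ℝ) ^ (-(2 / 5) : ℝ) = 8 * (8 : ℝ) ^ (-(7 / 5) : ℝ) := by
      nth_rewrite 2 [← Real.rpow_one 8]
      rw [← Real.rpow_add (by norm_num)]; norm_num
    rw [e8]
    simp only [Finset.sum_range_succ, Finset.sum_range_zero]
    norm_num only [Nat.cast_ofNat, Nat.cast_zero, Nat.cast_one, zero_add]
    have h2 := rpow_neg_seven_fifths_le (x := 2) (q := 0.379) (by norm_num) (by norm_num)
      (by norm_num)
    have h3 := rpow_neg_seven_fifths_le (x := 3) (q := 0.2149) (by norm_num) (by norm_num)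
      (by norm_num)
    have h4 := rpow_neg_seven_fifths_le (x := 4) (q := 0.1436) (by norm_num) (by norm_num)
      (by norm_num)
    have h5 := rpow_neg_seven_fifths_le (x := 5) (q := 0.1051) (by norm_num) (by norm_num)
      (by norm_num)
    have h6 := rpow_neg_seven_fifths_le (x := 6) (q := 0.0815) (by norm_num) (by norm_num)
      (by norm_num)
    have h7 := rpow_neg_seven_fifths_le (x := 7) (q := 0.0657) (by norm_num) (by norm_num)
      (by norm_num)
    have h8 := rpow_neg_seven_fifths_le (x := 8) (q := 0.05442) (by norm_num) (by norm_num)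
      (by norm_num)
    norm_num at *
    linarith
  have hge : ∀ k : ℕ, ∑ j ∈ Finset.range (8 + k), ((j : ℝ) + 1) ^ (-(7 / 5) : ℝ)
      + 5 / 2 * ((8 + k : ℕ) : ℝ) ^ (-(2 / 5) : ℝ) ≤ 3.14 := by
    intro k
    induction k with
    | zero => simpa using h8
    | succ k ih =>
      rw [← add_assoc, Finset.sum_range_succ]
      have := rpow_neg_seven_fifths_telescope (x := ((8 + k : ℕ) : ℝ)) (by positivity)
      rw [Nat.cast_succ (8 + k)]
      linarith
  have hpos : 0 ≤ 5 / 2 * ((8 + J : ℕ) : ℝ) ^ (-(2 / 5) : ℝ) := by positivity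
  have hmono : ∑ j ∈ Finset.range J, ((j : ℝ) + 1) ^ (-(7 / 5) : ℝ)
      ≤ ∑ j ∈ Finset.range (8 + J), ((j : ℝ) + 1) ^ (-(7 / 5) : ℝ) :=
    Finset.sum_le_sum_of_subset_of_nonneg (by simp)
      fun _ _ _ => by positivity
  linarith [hge J]

/-! ### Dyadic epochs and the curved boundary -/

/-- Logarithm of the inverse crossing probability granted to the epoch `[2 ^ j, 2 ^ (j + 1))`. -/
noncomputable def epochExponent (t : ℝ) (j : ℕ) : ℝ :=
  1.008 * Real.log (5.2 / t) + 1.4 * Real.log (((j : ℝ) + 1) * Real.log 2)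

theorem epochExponent_pos {t : ℝ} (ht0 : 0 < t) (ht1 : t ≤ 1) (j : ℕ) : 0 < epochExponent t j := by
  have h2 := Real.log_two_gt_d9
  have hx : (5.2 : ℝ) ≤ 5.2 / t := by rw [le_div_iff₀ ht0]; linarith
  -- The only possibly negative part of the exponent is at least `-1.4 / 2`, which `1.008 * 1`
  -- outweighs.
  have h1 : 1 < Real.log (5.2 / t) := by
    rw [Real.lt_log_iff_exp_lt (by positivity)]
    linarith [Real.exp_one_lt_d9]
  have h3 : -(1/2 : ℝ) ≤ Real.log (((j : ℝ) + 1) * Real.log 2) := by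
    have hj : (0 : ℝ) ≤ j := by positivity
    have hpos : 0 < ((j : ℝ) + 1) * Real.log 2 := by positivity
    have := Real.one_sub_inv_le_log_of_pos hpos
    have : (((j : ℝ) + 1) * Real.log 2)⁻¹ ≤ 3/2 := by
      rw [inv_le_comm₀ hpos (by norm_num)]
      nlinarith
    linarith
  unfold epochExponent
  linarith

/-- Each term is a constant times `(j + 1) ^ (-7/5)`, where `1.4 = 1.008 / 0.72`. The choice of
`5.2` pays for `(log 2) ^ (-7/5)` and the series: `1.6717 * 3.14 / 5.265 < 1`. -/
theorem sum_exp_neg_epochExponent_le {t : ℝ} (ht0 : 0 < t) (ht1 : t ≤ 1) (J : ℕ) :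
    ∑ j ∈ Finset.range J, Real.exp (-epochExponent t j) ≤ t := by
  have hL : 0 < Real.log 2 := by positivity
  have hterm : ∀ j : ℕ, Real.exp (-epochExponent t j)
      = (t / 5.2) ^ (1.008 : ℝ) * (Real.log 2) ^ (-(7 / 5) : ℝ)
        * ((j : ℝ) + 1) ^ (-(7 / 5) : ℝ) := by
    intro j
    have hj : (0 : ℝ) < (j : ℝ) + 1 := by positivity
    rw [Real.rpow_def_of_pos (by positivity), Real.rpow_def_of_pos hL, Real.rpow_def_of_pos hj,
      ← Real.exp_add, ← Real.exp_add, epochExponent, Real.log_mul hj.ne' hL.ne',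
      Real.log_div (by norm_num) ht0.ne', Real.log_div ht0.ne' (by norm_num)]
    ring_nf
  simp_rw [hterm]
  rw [← Finset.mul_sum]
  have hs := sum_rpow_neg_seven_fifths_le J
  have ht : (t / 5.2) ^ (1.008 : ℝ) ≤ t * (5.2 : ℝ) ^ (-(1.008) : ℝ) := by
    rw [Real.div_rpow ht0.le (by norm_num), Real.rpow_neg (by norm_num), ← div_eq_mul_inv]
    gcongr
    calc t ^ (1.008 : ℝ) ≤ t ^ (1 : ℝ) :=
          Real.rpow_le_rpow_of_exponent_ge ht0 ht1 (by norm_num)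
      _ = t := Real.rpow_one t
  have hlog : (Real.log 2) ^ (-(7 / 5) : ℝ) ≤ 1.6717 := by
    refine rpow_neg_seven_fifths_le hL (by norm_num) ?_
    have : (0.69314 : ℝ) ≤ Real.log 2 := by linarith [Real.log_two_gt_d9]
    calc (1 : ℝ) ≤ 1.6717 ^ 5 * 0.69314 ^ 7 := by norm_num
      _ ≤ _ := by gcongr
  have h52 : (5.2 : ℝ) ^ (-(1.008) : ℝ) ≤ 1 / 5.265 := by
    rw [Real.rpow_neg (by norm_num), ← one_div]
    refine one_div_le_one_div_of_le (by norm_num) ?_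
    -- As `1.008 = 126 / 125`, the 125th power makes the comparison rational.
    refine le_of_pow_le_pow_left₀ (n := 125) (by norm_num) (by positivity) ?_
    rw [← Real.rpow_natCast (5.2 ^ (1.008 : ℝ)), ← Real.rpow_mul (by norm_num)]
    have : (1.008 : ℝ) * (125 : ℕ) = (126 : ℕ) := by norm_num
    rw [this, Real.rpow_natCast]
    norm_num
  calc (t / 5.2) ^ (1.008 : ℝ) * (Real.log 2) ^ (-(7 / 5) : ℝ)
        * ∑ j ∈ Finset.range J, ((j : ℝ) + 1) ^ (-(7 / 5) : ℝ)
      ≤ (t * (1 / 5.265)) * 1.6717 * 3.14 := by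
        have : (t / 5.2) ^ (1.008 : ℝ) ≤ t * (1 / 5.265) := ht.trans (by gcongr)
        have h0 : 0 ≤ ∑ j ∈ Finset.range J, ((j : ℝ) + 1) ^ (-(7 / 5) : ℝ) :=
          Finset.sum_nonneg fun _ _ => by positivity
        gcongr
    _ ≤ t := by nlinarith

/-- The difference of the two sides is convex in `u`, so only `u = 1` and `u = 2` matter. The slope
parameter `1.41 ≈ √2` nearly balances the two endpoints. -/
theorem stitching_quadratic {u : ℝ} (h1 : 1 ≤ u) (h2 : u ≤ 2) :
    (1 + 1.41 * u / 2) ^ 2 ≤ 1.41 * (2.0808 / 1.008) * u := by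
  nlinarith [mul_nonneg (sub_nonneg.2 h1) (sub_nonneg.2 h2)]

/-- On the epoch `2 ^ j ≤ k < 2 ^ (j + 1)` the curved boundary lies above a line. -/
theorem epochExponent_le_of_boundary {t s : ℝ} (ht0 : 0 < t) (ht1 : t ≤ 1) {j k : ℕ}
    (hjk : 2 ^ j ≤ k) (hkj : k < 2 ^ (j + 1))
    (h : 5.2 * Real.exp (-(max s 0) ^ 2 / (2.0808 * (k : ℝ))
        + Real.log (Real.log (2 * (k : ℝ))) / 0.72) ≤ t) :
    epochExponent t j ≤ √(1.41 * epochExponent t j / 2 ^ j) * s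
      - √(1.41 * epochExponent t j / 2 ^ j) ^ 2 / 2 * k := by
  have hc := epochExponent_pos ht0 ht1 j
  set c := epochExponent t j with hcdef
  have hL : 0 < Real.log 2 := by positivity
  have hk0 : (0 : ℝ) < k := by exact_mod_cast (by positivity : 0 < 2 ^ j).trans_le hjk
  have hp : (0 : ℝ) < 2 ^ j := by positivity
  set u := (k : ℝ) / 2 ^ j with hu
  have hk : (k : ℝ) = u * 2 ^ j := by rw [hu]; field_simp
  have hu1 : 1 ≤ u := by rw [hu, le_div_iff₀ hp, one_mul]; exact_mod_cast hjk
  have hu2 : u ≤ 2 := by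
    rw [hu, div_le_iff₀ hp]
    have : (k : ℝ) ≤ (2 ^ (j + 1) : ℕ) := by exact_mod_cast hkj.le
    rw [pow_succ] at this
    push_cast at this
    linarith
  have hll : Real.log (((j : ℝ) + 1) * Real.log 2) ≤ Real.log (Real.log (2 * (k : ℝ))) := by
    apply Real.log_le_log (by positivity)
    have : ((j : ℝ) + 1) * Real.log 2 = Real.log (2 * 2 ^ j) := by
      rw [← pow_succ', Real.log_pow]; push_cast; ring
    rw [this]
    apply Real.log_le_log (by positivity)
    have : ((2 ^ j : ℕ) : ℝ) ≤ k := by exact_mod_cast hjk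
    push_cast at this
    linarith
  have hsq : 2.0808 / 1.008 * k * c ≤ (max s 0) ^ 2 := by
    have h' : -(max s 0) ^ 2 / (2.0808 * (k : ℝ)) + Real.log (Real.log (2 * (k : ℝ))) / 0.72
        ≤ -Real.log (5.2 / t) := by
      rw [← Real.log_inv, inv_div, Real.le_log_iff_exp_le (by positivity), le_div_iff₀ (by norm_num)]
      linarith
    have h'' : c / 1.008 ≤ (max s 0) ^ 2 / (2.0808 * (k : ℝ)) := by
      have : c / 1.008 = Real.log (5.2 / t) + Real.log (((j : ℝ) + 1) * Real.log 2) / 0.72 := by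
        rw [hcdef, epochExponent]; ring
      rw [this]
      rw [neg_div] at h'
      have hll' := div_le_div_of_nonneg_right hll (show (0 : ℝ) ≤ 0.72 by norm_num)
      linarith
    rw [le_div_iff₀ (by positivity)] at h''
    calc 2.0808 / 1.008 * k * c = c / 1.008 * (2.0808 * k) := by ring
      _ ≤ _ := h''
  set l := √(1.41 * c / 2 ^ j) with hl
  have hl0 : 0 < l := Real.sqrt_pos.2 (by positivity)
  have hl2 : l ^ 2 = 1.41 * c / 2 ^ j := Real.sq_sqrt (by positivity)
  -- With `k = u * 2 ^ j` the line condition reads `c * (1 + 1.41 * u / 2) ≤ l * s`; squaring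
  -- reduces it to `stitching_quadratic`.
  have hkey : (c * (1 + 1.41 * u / 2)) ^ 2 ≤ (l * max s 0) ^ 2 := by
    calc (c * (1 + 1.41 * u / 2)) ^ 2 = c ^ 2 * (1 + 1.41 * u / 2) ^ 2 := by ring
      _ ≤ c ^ 2 * (1.41 * (2.0808 / 1.008) * u) := by gcongr; exact stitching_quadratic hu1 hu2
      _ = 1.41 * c / 2 ^ j * (2.0808 / 1.008 * k * c) := by rw [hk]; field_simp
      _ ≤ l ^ 2 * (max s 0) ^ 2 := by rw [hl2]; gcongr
      _ = _ := by ring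
  have hkey' : c * (1 + 1.41 * u / 2) ≤ l * max s 0 :=
    le_of_sq_le_sq hkey (by positivity)
  have hs : max s 0 = s := by
    apply max_eq_left
    by_contra hneg
    rw [max_eq_right (not_le.1 hneg).le, mul_zero] at hkey'
    have : 0 < c * (1 + 1.41 * u / 2) := by positivity
    linarith
  rw [hs] at hkey'
  have : l ^ 2 / 2 * k = c * (1.41 * u / 2) := by rw [hl2, hk]; field_simp
  rw [this]
  linarith

/-! ### Maximal inequalities for independent variables -/

/-- Ville's maximal inequality for products of independent variables of mean at most one. -/
theorem measure_exists_le_prod_mul_le {N : ℕ} (μ : Fin N → Measure ℝ)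
    [∀ i, IsProbabilityMeasure (μ i)] (Z : Fin N → ℝ → ℝ≥0∞) (hZ : ∀ i, Measurable (Z i))
    (hZ1 : ∀ i, ∫⁻ y, Z i y ∂(μ i) ≤ 1) (a c : ℝ≥0∞) :
    a * Measure.pi μ {y | ∃ k : ℕ, a ≤ c * ∏ i : Fin N, if (i : ℕ) < k then Z i (y i) else 1}
      ≤ c := by
  induction N generalizing c with
  | zero =>
    by_cases h : a ≤ c
    · exact (mul_le_of_le_one_right' prob_le_one).trans h
    · simp [h]
  | succ N ih =>
    by_cases h : a ≤ c
    · exact (mul_le_of_le_one_right' prob_le_one).trans h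
    have hmp := measurePreserving_piFinSuccAbove μ 0
    set A : Set (ℝ × (Fin N → ℝ)) := {q | ∃ k : ℕ,
      a ≤ c * Z 0 q.1 * ∏ i : Fin N, if (i : ℕ) < k then Z i.succ (q.2 i) else 1} with hA
    have hAm : MeasurableSet A := by
      simp only [hA, Set.ofPred_exists]
      refine MeasurableSet.iUnion fun k => measurableSet_le measurable_const ?_
      refine ((hZ 0).comp measurable_fst).const_mul c |>.mul ?_
      refine Finset.measurable_prod _ fun i _ => ?_
      by_cases hi : (i : ℕ) < k
      · simp only [hi, if_true]
        exact (hZ i.succ).comp ((measurable_pi_apply i).comp measurable_snd)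
      · simp only [hi, if_false]
        exact measurable_const
    have hsub : {y : Fin (N + 1) → ℝ | ∃ k : ℕ,
        a ≤ c * ∏ i : Fin (N + 1), if (i : ℕ) < k then Z i (y i) else 1}
        ⊆ MeasurableEquiv.piFinSuccAbove (fun _ => ℝ) 0 ⁻¹' A := by
      rintro y ⟨k, hk⟩
      rcases k with _ | k
      -- The empty product would give `a ≤ c`, excluded here; so the first factor is always present.
      · simp [h] at hk
      · refine ⟨k, ?_⟩
        rw [Fin.prod_univ_succ] at hk
        simpa [mul_assoc, MeasurableEquiv.piFinSuccAbove, Fin.removeNth, Fin.insertNthEquiv,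
          Fin.tail] using hk
    calc a * Measure.pi μ _ ≤ a * Measure.pi μ
          (MeasurableEquiv.piFinSuccAbove (fun _ => ℝ) 0 ⁻¹' A) := by gcongr
      _ = a * ((μ 0).prod (Measure.pi fun j => μ (Fin.succAbove 0 j))) A := by
          rw [hmp.measure_preimage hAm.nullMeasurableSet]
      _ = ∫⁻ y, a * Measure.pi (fun j : Fin N => μ j.succ) (Prod.mk y ⁻¹' A) ∂(μ 0) := by
          rw [Measure.prod_apply hAm, lintegral_const_mul _ (measurable_measure_prodMk_left hAm)]
          simp
      _ ≤ ∫⁻ y, c * Z 0 y ∂(μ 0) := by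
          refine lintegral_mono fun y => ?_
          -- Given the first coordinate, its factor is absorbed into the starting capital `c`; this
          -- is why `c` is general.
          exact ih (fun j => μ j.succ) (fun j => Z j.succ) (fun j => hZ _) (fun j => hZ1 _)
            (c * Z 0 y)
      _ ≤ c := by
          rw [lintegral_const_mul _ (hZ 0)]
          exact mul_le_of_le_one_right' (hZ1 0)

theorem measure_exists_exp_crossing_le {N : ℕ} (μ : Fin N → Measure ℝ)
    [∀ i, IsProbabilityMeasure (μ i)] (g : ℝ → ℝ) (hg : Measurable g) {l : ℝ}
    (hmgf : ∀ i, ∫⁻ y, ENNReal.ofReal (Real.exp (l * g y)) ∂(μ i)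
      ≤ ENNReal.ofReal (Real.exp (l ^ 2 / 2))) (c : ℝ) :
    Measure.pi μ {y | ∃ k ≤ N, c ≤ l * (∑ i : Fin N, if (i : ℕ) < k then g (y i) else 0)
        - l ^ 2 / 2 * k} ≤ ENNReal.ofReal (Real.exp (-c)) := by
  have hV := measure_exists_le_prod_mul_le μ
    (fun _ y => ENNReal.ofReal (Real.exp (l * g y - l ^ 2 / 2))) (fun _ => by fun_prop)
    (fun i => by
      have : ∀ y, ENNReal.ofReal (Real.exp (l * g y - l ^ 2 / 2))
          = ENNReal.ofReal (Real.exp (l * g y)) * ENNReal.ofReal (Real.exp (-(l ^ 2 / 2))) := by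
        intro y
        rw [← ENNReal.ofReal_mul (by positivity), ← Real.exp_add]; ring_nf
      simp_rw [this]
      rw [lintegral_mul_const _ (by fun_prop)]
      calc _ ≤ ENNReal.ofReal (Real.exp (l ^ 2 / 2)) * ENNReal.ofReal (Real.exp (-(l ^ 2 / 2))) := by
            gcongr; exact hmgf i
        _ = 1 := by
            rw [← ENNReal.ofReal_mul (by positivity), ← Real.exp_add]; simp)
    (ENNReal.ofReal (Real.exp c)) 1
  have hsub : {y : Fin N → ℝ | ∃ k ≤ N,
      c ≤ l * (∑ i : Fin N, if (i : ℕ) < k then g (y i) else 0) - l ^ 2 / 2 * k}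
      ⊆ {y | ∃ k : ℕ, ENNReal.ofReal (Real.exp c) ≤ 1 * ∏ i : Fin N, if (i : ℕ) < k then
        ENNReal.ofReal (Real.exp (l * g (y i) - l ^ 2 / 2)) else 1} := by
    rintro y ⟨k, hkN, hk⟩
    refine ⟨k, ?_⟩
    have e : ∀ i : Fin N, (if (i : ℕ) < k then
        ENNReal.ofReal (Real.exp (l * g (y i) - l ^ 2 / 2)) else 1)
        = ENNReal.ofReal (Real.exp (if (i : ℕ) < k then l * g (y i) - l ^ 2 / 2 else 0)) := by
      intro i; split_ifs <;> simp
    simp_rw [e]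
    rw [one_mul, ← ENNReal.ofReal_prod_of_nonneg (fun _ _ => by positivity), ← Real.exp_sum]
    gcongr
    refine hk.trans (le_of_eq ?_)
    have e2 : ∀ i : Fin N, (if (i : ℕ) < k then l * g (y i) - l ^ 2 / 2 else 0)
        = l * (if (i : ℕ) < k then g (y i) else 0) - if (i : ℕ) < k then l ^ 2 / 2 else 0 := by
      intro i; split_ifs <;> simp
    simp_rw [e2]
    rw [Finset.sum_sub_distrib, ← Finset.mul_sum, ← Finset.sum_filter _ (fun _ => l ^ 2 / 2),
      Finset.sum_const]
    have : (Finset.univ.filter fun i : Fin N => (i : ℕ) < k).card = k := by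
      rw [Fin.card_filter_val_lt, min_eq_right hkN]
    rw [this, nsmul_eq_mul]; ring
  have hV' := (mul_le_mul_right (measure_mono hsub) (ENNReal.ofReal (Real.exp c))).trans hV
  rw [Real.exp_neg, ENNReal.ofReal_inv_of_pos (by positivity), ← one_div,
    ENNReal.le_div_iff_mul_le (by simp [Real.exp_pos]) (by simp), mul_comm]
  exact hV'

/-- A time-uniform law of the iterated logarithm bound for independent sub-Gaussian variables. -/
theorem measure_exists_curved_boundary_le {N : ℕ} (μ : Fin N → Measure ℝ)
    [∀ i, IsProbabilityMeasure (μ i)] (g : ℝ → ℝ) (hg : Measurable g)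
    (hmgf : ∀ i, ∀ l : ℝ, 0 ≤ l → ∫⁻ y, ENNReal.ofReal (Real.exp (l * g y)) ∂(μ i)
      ≤ ENNReal.ofReal (Real.exp (l ^ 2 / 2))) {t : ℝ} (ht0 : 0 < t) (ht1 : t ≤ 1) :
    Measure.pi μ {y | ∃ k ∈ Finset.Icc 1 N,
      5.2 * Real.exp (-(max (∑ i : Fin N, if (i : ℕ) < k then g (y i) else 0) 0) ^ 2
          / (2.0808 * (k : ℝ)) + Real.log (Real.log (2 * (k : ℝ))) / 0.72) ≤ t}
      ≤ ENNReal.ofReal t := by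
  set l : ℕ → ℝ := fun j => √(1.41 * epochExponent t j / 2 ^ j)
  set E : ℕ → Set (Fin N → ℝ) := fun j => {y | ∃ k ≤ N, epochExponent t j ≤
    l j * (∑ i : Fin N, if (i : ℕ) < k then g (y i) else 0) - l j ^ 2 / 2 * k}
  calc Measure.pi μ _ ≤ Measure.pi μ (⋃ j ∈ Finset.range (N + 1), E j) := by
        refine measure_mono ?_
        rintro y ⟨k, hk, hy⟩
        rw [Finset.mem_Icc] at hk
        simp only [Set.mem_iUnion]
        -- The epoch containing `k`.
        refine ⟨Nat.log 2 k, ?_, k, hk.2, ?_⟩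
        · rw [Finset.mem_range]
          have := Nat.log_le_self 2 k
          omega
        · exact epochExponent_le_of_boundary ht0 ht1 (Nat.pow_log_le_self 2 (by omega))
            (Nat.lt_pow_succ_log_self (by norm_num) k) hy
    _ ≤ ∑ j ∈ Finset.range (N + 1), Measure.pi μ (E j) := measure_biUnion_finset_le _ _
    _ ≤ ∑ j ∈ Finset.range (N + 1), ENNReal.ofReal (Real.exp (-epochExponent t j)) :=
        Finset.sum_le_sum fun j _ => measure_exists_exp_crossing_le μ g hg
          (fun i => hmgf i _ (Real.sqrt_nonneg _)) _
    _ = ENNReal.ofReal (∑ j ∈ Finset.range (N + 1), Real.exp (-epochExponent t j)) :=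
        (ENNReal.ofReal_sum_of_nonneg fun _ _ => by positivity).symm
    _ ≤ ENNReal.ofReal t :=
        ENNReal.ofReal_le_ofReal (sum_exp_neg_epochExponent_le ht0 ht1 _)

/-! ### Nearest-neighbour enumeration and validity of the p-values -/

theorem map_pi_comp_injective {ι κ : Type*} [Fintype ι] [Fintype κ] (ν : ι → Measure ℝ)
    [∀ i, IsProbabilityMeasure (ν i)] {e : κ → ι} (he : Function.Injective e) :
    (Measure.pi ν).map (fun y j => y (e j)) = Measure.pi fun j => ν (e j) := by
  have h := (iIndepFun_pi (μ := ν) (X := fun _ => id) fun _ => aemeasurable_id).precomp he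
  refine ((iIndepFun_iff_map_fun_eq_pi_map
    fun j => (measurable_pi_apply (e j)).aemeasurable).1 h).trans ?_
  congr 1
  funext j
  exact (measurePreserving_eval ν (e j)).map_eq

namespace ISS

variable {n d : ℕ}

theorem pValue_pos (σ τ : ℝ) (D : Fin n → (Fin d → ℝ) × ℝ) (x : Fin d → ℝ) :
    0 < pValue σ τ D x := by
  unfold pValue
  split_ifs with h
  · refine lt_min one_pos ?_
    rw [Finset.lt_inf'_iff]
    intro k _
    positivity
  · exact one_pos

theorem mem_lowerIdx {X : Fin n → Fin d → ℝ} {x : Fin d → ℝ} {i : Fin n} :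
    i ∈ lowerIdx X x ↔ X i ≤ x := by simp [lowerIdx]

theorem neighbourRank_lt {X : Fin n → Fin d → ℝ} {x : Fin d → ℝ} {i j : Fin n}
    (hj : j ∈ lowerIdx X x)
    (h : ‖X i - x‖ < ‖X j - x‖ ∨ (‖X i - x‖ = ‖X j - x‖ ∧ i < j)) :
    neighbourRank X x i < neighbourRank X x j := by
  classical
  refine Finset.card_lt_card ⟨fun l hl => ?_, fun hsub => ?_⟩
  · rw [Finset.mem_filter] at hl ⊢
    refine ⟨hl.1, ?_⟩
    rcases hl.2 with h1 | h1 <;> rcases h with h2 | h2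
    · exact Or.inl (h1.trans h2)
    · exact Or.inl (h2.1 ▸ h1)
    · exact Or.inl (h1.1 ▸ h2)
    · exact Or.inr ⟨h1.1.trans h2.1, h1.2.trans h2.2.le⟩
  · have hjj := hsub (Finset.mem_filter.2 ⟨hj, Or.inr ⟨rfl, le_rfl⟩⟩)
    rcases (Finset.mem_filter.1 hjj).2 with h1 | h1 <;> rcases h with h2 | h2
    · exact lt_asymm h1 h2
    · exact h1.ne h2.1.symm
    · exact h2.ne h1.1.symm
    · exact h1.2.not_gt h2.2

theorem neighbourRank_injOn (X : Fin n → Fin d → ℝ) (x : Fin d → ℝ) :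
    Set.InjOn (neighbourRank X x) (lowerIdx X x) := by
  intro i hi j hj hij
  by_contra hne
  rcases lt_trichotomy ‖X i - x‖ ‖X j - x‖ with h | h | h
  · exact (neighbourRank_lt hj (Or.inl h)).ne hij
  · rcases lt_or_gt_of_ne hne with h' | h'
    · exact (neighbourRank_lt hj (Or.inr ⟨h, h'⟩)).ne hij
    · exact (neighbourRank_lt hi (Or.inr ⟨h.symm, h'⟩)).ne hij.symm
  · exact (neighbourRank_lt hi (Or.inl h)).ne hij.symm

theorem neighbourRank_mem_Icc {X : Fin n → Fin d → ℝ} {x : Fin d → ℝ} {i : Fin n}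
    (hi : i ∈ lowerIdx X x) : neighbourRank X x i ∈ Finset.Icc 1 (lowerIdx X x).card := by
  classical
  rw [Finset.mem_Icc]
  exact ⟨Finset.card_pos.2 ⟨i, Finset.mem_filter.2 ⟨hi, Or.inr ⟨rfl, le_rfl⟩⟩⟩,
    Finset.card_le_card (Finset.filter_subset _ _)⟩

/-- The observations below `x` can be enumerated by their distance to `x`. -/
theorem exists_neighbour_enumeration (X : Fin n → Fin d → ℝ) (x : Fin d → ℝ) :
    ∃ e : Fin (lowerIdx X x).card → Fin n, Function.Injective e ∧ (∀ j, X (e j) ≤ x) ∧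
      ∀ (f : Fin n → ℝ) (k : ℕ),
        ∑ i ∈ (lowerIdx X x).filter (fun i => neighbourRank X x i ≤ k), f i
          = ∑ j : Fin (lowerIdx X x).card, if (j : ℕ) < k then f (e j) else 0 := by
  classical
  set N := (lowerIdx X x).card with hN
  -- Ranks start at `1`, positions in `Fin N` at `0`; hence rank `≤ k` becomes position `< k`.
  let r : lowerIdx X x → Fin N := fun i => ⟨neighbourRank X x i - 1, by
    have := Finset.mem_Icc.1 (neighbourRank_mem_Icc i.2)
    omega⟩
  have hr : Function.Injective r := by
    intro i j hij
    have h1 := Finset.mem_Icc.1 (neighbourRank_mem_Icc i.2)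
    have h2 := Finset.mem_Icc.1 (neighbourRank_mem_Icc j.2)
    have h3 : neighbourRank X x i - 1 = neighbourRank X x j - 1 := congrArg Fin.val hij
    exact Subtype.ext (neighbourRank_injOn X x i.2 j.2 (by omega))
  have hb : Function.Bijective r :=
    (Fintype.bijective_iff_injective_and_card r).2 ⟨hr, by simp [hN]⟩
  let e := Equiv.ofBijective r hb
  refine ⟨fun j => (e.symm j : Fin n), Subtype.val_injective.comp e.symm.injective,
    fun j => mem_lowerIdx.1 (e.symm j).2, fun f k => ?_⟩
  rw [Finset.sum_filter, ← Finset.sum_coe_sort,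
    ← e.sum_comp (fun j => if (j : ℕ) < k then f (e.symm j) else 0)]
  refine Finset.sum_congr rfl fun i _ => ?_
  have h1 := Finset.mem_Icc.1 (neighbourRank_mem_Icc i.2)
  have h2 : ((e i : Fin N) : ℕ) = neighbourRank X x i - 1 := rfl
  have h3 : neighbourRank X x i ≤ k ↔ ((e i : Fin N) : ℕ) < k := by omega
  simp only [h3, Equiv.symm_apply_apply]

/-- The p-values are valid for independent responses given the covariates. -/
theorem measure_pValue_le {σ τ : ℝ} (hσ : 0 < σ) (X : Fin n → Fin d → ℝ) (x : Fin d → ℝ)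
    (ν : Fin n → Measure ℝ) [∀ i, IsProbabilityMeasure (ν i)] (m : Fin n → ℝ)
    (hν : ∀ i, HasSubgaussianMGF (fun y : ℝ => y - m i) (⟨σ ^ 2, sq_nonneg σ⟩ : ℝ≥0) (ν i))
    (hm : ∀ i, X i ≤ x → m i ≤ τ) {t : ℝ} (ht0 : 0 ≤ t) (ht1 : t < 1) :
    Measure.pi ν {y | pValue σ τ (fun i => (X i, y i)) x ≤ t} ≤ ENNReal.ofReal t := by
  rcases ht0.eq_or_lt with rfl | ht
  · have : {y : Fin n → ℝ | pValue σ τ (fun i => (X i, y i)) x ≤ 0} = ∅ := by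
      ext y
      simpa using pValue_pos σ τ (fun i => (X i, y i)) x
    rw [this]
    simp
  obtain ⟨e, he, hex, hsum⟩ := exists_neighbour_enumeration X x
  have hcov : ∀ y : Fin n → ℝ, covariates (fun i => (X i, y i)) = X := fun y => rfl
  have hg : Measurable fun y : ℝ => (y - τ) / σ := by fun_prop
  have hmgf : ∀ j, ∀ l : ℝ, 0 ≤ l →
      ∫⁻ y, ENNReal.ofReal (Real.exp (l * ((y - τ) / σ))) ∂(ν (e j))
        ≤ ENNReal.ofReal (Real.exp (l ^ 2 / 2)) := by
    intro j l hl
    have h := hν (e j)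
    calc ∫⁻ y, ENNReal.ofReal (Real.exp (l * ((y - τ) / σ))) ∂(ν (e j))
        -- Replacing `τ` by the smaller mean increases the exponent because `l ≥ 0`; only
        -- nonnegative slopes are available.
        ≤ ∫⁻ y, ENNReal.ofReal (Real.exp (l / σ * (y - m (e j)))) ∂(ν (e j)) := by
          refine lintegral_mono fun y => ?_
          have := hm _ (hex j)
          rw [mul_div_assoc', div_mul_eq_mul_div]
          gcongr
      _ = ENNReal.ofReal (mgf (fun y => y - m (e j)) (ν (e j)) (l / σ)) := by
          rw [mgf, ofReal_integral_eq_lintegral_ofReal (h.integrable_exp_mul _)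
            (Filter.Eventually.of_forall fun _ => by positivity)]
      _ ≤ ENNReal.ofReal (Real.exp (l ^ 2 / 2)) := by
          refine ENNReal.ofReal_le_ofReal ((h.mgf_le _).trans (le_of_eq ?_))
          congr 1
          change σ ^ 2 * (l / σ) ^ 2 / 2 = _
          field_simp
  have hlil := measure_exists_curved_boundary_le (fun j => ν (e j)) _ hg hmgf ht ht1.le
  rw [← map_pi_comp_injective ν he] at hlil
  -- This inequality for image measures holds for every set, so the crossing event need not be shown
  -- measurable.
  refine le_trans ?_ ((Measure.le_map_apply
    (measurable_pi_iff.2 fun j => measurable_pi_apply (e j)).aemeasurable _).trans hlil)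
  refine measure_mono fun y hy => ?_
  simp only [Set.mem_ofPred_eq, pValue, hcov] at hy
  -- Since `t < 1`, neither the truncation at `1` nor the default value `1` can produce the event.
  split_ifs at hy with hne
  · rw [min_le_iff, Finset.inf'_le_iff] at hy
    rcases hy with hy | ⟨k, hk, hy⟩
    · linarith
    · refine ⟨k, hk, ?_⟩
      rw [partialSum, hcov, hsum (fun i => (y i - τ) / σ)] at hy
      exact hy
  · linarith

end ISS

/-! ### Familywise error control on the weighted graph -/

namespace ISS.PolyforestWeightedDAG

variable {I : Type*}

theorem fAdj_unique (G : PolyforestWeightedDAG I) {i j k : I} (hj : G.FAdj j i) (hk : G.FAdj k i) :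
    j = k :=
  G.polyforest i j k hj.1 (by rw [hj.2]; exact one_pos) hk.1 (by rw [hk.2]; exact one_pos)

theorem mem_of_transGen_adj {G : PolyforestWeightedDAG I} {T : Finset I}
    (hT : ∀ i j, G.Adj i j → j ∈ T → i ∈ T) {i j : I} (h : Relation.TransGen G.Adj i j)
    (hj : j ∈ T) : i ∈ T := by
  induction h with
  | single h => exact hT _ _ h hj
  | tail _ h ih => exact ih (hT _ _ h hj)

theorem transGen_adj_of_fAdj {G : PolyforestWeightedDAG I} {i j : I}
    (h : Relation.TransGen G.FAdj i j) : Relation.TransGen G.Adj i j :=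
  Relation.TransGen.mono (fun _ _ h => h.1) _ _ h

/-- Parents in the polyforest are unique, so the ancestors of a vertex form a chain. -/
theorem reflTransGen_fAdj_total {G : PolyforestWeightedDAG I} {i j k : I}
    (hi : Relation.ReflTransGen G.FAdj i k) (hj : Relation.ReflTransGen G.FAdj j k) :
    Relation.ReflTransGen G.FAdj i j ∨ Relation.ReflTransGen G.FAdj j i := by
  have h := Relation.ReflTransGen.total_of_right_unique (r := Function.swap G.FAdj)
    (fun a b c hb hc => G.fAdj_unique hb hc) (Relation.reflTransGen_swap.2 hi)
    (Relation.reflTransGen_swap.2 hj)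
  exact h.symm.imp Relation.reflTransGen_swap.1 Relation.reflTransGen_swap.1

variable [Fintype I]

theorem budget_nonneg (G : PolyforestWeightedDAG I) {α : ℝ} (hα : 0 ≤ α) (R : Finset I) (i : I) :
    0 ≤ G.budget α R i := by
  unfold budget
  split_ifs <;> positivity

theorem mem_unrejectedLeaves {G : PolyforestWeightedDAG I} {R : Finset I} {i : I} :
    i ∈ G.unrejectedLeaves R ↔ (∀ j, ¬ G.FAdj i j) ∧ i ∉ R := by simp [unrejectedLeaves]

theorem mem_candidates {G : PolyforestWeightedDAG I} {R : Finset I} {i : I} :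
    i ∈ G.candidates R ↔ i ∉ R ∧ ∀ j, G.FAdj j i → j ∈ R := by simp [candidates]

/-- The budget of a vertex outside an upper set `T` only grows when the rejected set grows to
`T`. -/
theorem budget_mono {G : PolyforestWeightedDAG I} {T : Finset I}
    (hT : ∀ i j, G.Adj i j → j ∈ T → i ∈ T) {α : ℝ} (hα : 0 ≤ α) {R : Finset I} (hR : R ⊆ T)
    {i : I} (hi : i ∉ T) : G.budget α R i ≤ G.budget α T i := by
  classical
  by_cases hc : i ∈ G.candidates R
  · have hc' : i ∈ G.candidates T :=
      mem_candidates.2 ⟨hi, fun j hj => hR ((mem_candidates.1 hc).2 j hj)⟩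
    have hsub : G.unrejectedLeaves T ⊆ G.unrejectedLeaves R := fun j hj =>
      mem_unrejectedLeaves.2
        ⟨(mem_unrejectedLeaves.1 hj).1, fun h => (mem_unrejectedLeaves.1 hj).2 (hR h)⟩
    -- No descendant of `i ∉ T` lies in `T`, so enlarging `R` to `T` removes no leaf below `i`: the
    -- numerator stays and the denominator shrinks.
    have hnum : (G.unrejectedLeaves R).filter (fun j => j = i ∨ Relation.TransGen G.FAdj i j)
        = (G.unrejectedLeaves T).filter (fun j => j = i ∨ Relation.TransGen G.FAdj i j) := by
      refine Finset.Subset.antisymm (fun j hj => ?_) (Finset.filter_subset_filter _ hsub)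
      rw [Finset.mem_filter] at hj ⊢
      refine ⟨mem_unrejectedLeaves.2 ⟨(mem_unrejectedLeaves.1 hj.1).1, fun hjT => hi ?_⟩, hj.2⟩
      rcases hj.2 with rfl | h
      · exact hjT
      · exact mem_of_transGen_adj hT (transGen_adj_of_fAdj h) hjT
    simp only [budget, if_pos hc, if_pos hc']
    have hnum' := congrArg Finset.card hnum
    -- With no leaf left the quotient at `T` is `0` by convention, but then the common numerator
    -- vanishes too.
    rcases (G.unrejectedLeaves T).card.eq_zero_or_pos with h0 | hpos
    · have h1 : ((G.unrejectedLeaves T).filter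
          (fun j => j = i ∨ Relation.TransGen G.FAdj i j)).card = 0 :=
        Nat.le_zero.1 (h0 ▸ Finset.card_le_card (Finset.filter_subset _ _))
      rw [h1] at hnum'
      rw [hnum']
      simp only [Nat.cast_zero, zero_mul, zero_div]
      positivity
    · rw [hnum']
      have := Finset.card_le_card hsub
      gcongr
  · rw [budget, if_neg hc]
    exact budget_nonneg G hα T i

/-- A strict descendant of a candidate has its parent unrejected, since `T` is closed under
ancestors, so it is not a candidate itself. -/
theorem eq_of_mem_candidates {G : PolyforestWeightedDAG I} {T : Finset I}
    (hT : ∀ i j, G.Adj i j → j ∈ T → i ∈ T) {i j : I} (hi : i ∈ G.candidates T)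
    (hj : j ∈ G.candidates T) (h : Relation.ReflTransGen G.FAdj i j) : i = j := by
  rcases Relation.ReflTransGen.cases_tail h with h | ⟨c, hc, hcj⟩
  · exact h.symm
  · have hcT := (mem_candidates.1 hj).2 c hcj
    rcases Relation.reflTransGen_iff_eq_or_transGen.1 hc with rfl | h'
    · exact absurd hcT (mem_candidates.1 hi).1
    · exact absurd (mem_of_transGen_adj hT (transGen_adj_of_fAdj h') hcT) (mem_candidates.1 hi).1

/-- A leaf below two candidates would make them comparable, hence equal; so each unrejected leaf is
counted at most once. -/
theorem sum_budget_le {G : PolyforestWeightedDAG I} {T : Finset I}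
    (hT : ∀ i j, G.Adj i j → j ∈ T → i ∈ T) {α : ℝ} (hα : 0 ≤ α) :
    ∑ i, G.budget α T i ≤ α := by
  classical
  set L := G.unrejectedLeaves T with hL
  have hcard : ∑ i ∈ G.candidates T,
      (L.filter fun j => j = i ∨ Relation.TransGen G.FAdj i j).card ≤ L.card := by
    rw [← Finset.card_biUnion]
    · exact Finset.card_le_card (Finset.biUnion_subset.2 fun _ _ => Finset.filter_subset _ _)
    · intro i hi j hj hij
      rw [Function.onFun, Finset.disjoint_left]
      intro k hki hkj
      rw [Finset.mem_filter, ← Relation.reflTransGen_iff_eq_or_transGen] at hki hkj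
      rcases reflTransGen_fAdj_total hki.2 hkj.2 with h | h
      · exact hij (eq_of_mem_candidates hT hi hj h)
      · exact hij (eq_of_mem_candidates hT hj hi h).symm
  have hsum : ∑ i, G.budget α T i = (∑ i ∈ G.candidates T,
      ((L.filter fun j => j = i ∨ Relation.TransGen G.FAdj i j).card : ℝ)) * α / L.card := by
    simp only [budget]
    rw [← Finset.sum_filter, Finset.filter_mem_eq_inter, Finset.univ_inter, Finset.sum_mul,
      Finset.sum_div]
  rw [hsum]
  have hcard' : ∑ i ∈ G.candidates T,
      ((L.filter fun j => j = i ∨ Relation.TransGen G.FAdj i j).card : ℝ) ≤ L.card := by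
    exact_mod_cast hcard
  refine div_le_of_le_mul₀ (by positivity) hα ?_
  rw [mul_comm α]
  gcongr

/-- The procedure can only make a false rejection if the p-value of some null hypothesis is at most
its budget given that precisely the false hypotheses have been rejected. -/
theorem exists_le_budget_of_not_subset {G : PolyforestWeightedDAG I} {T : Finset I}
    (hT : ∀ i j, G.Adj i j → j ∈ T → i ∈ T) {α : ℝ} (hα : 0 ≤ α) {p : I → ℝ}
    (h : ¬ G.rejectedSet α p ⊆ T) : ∃ i ∉ T, p i ≤ G.budget α T i := by
  classical
  by_contra! hno
  refine h ?_
  have key : ∀ ℓ : ℕ, (G.step α p)^[ℓ] ∅ ⊆ T := by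
    intro ℓ
    induction ℓ with
    | zero => simp
    | succ ℓ ih =>
      rw [Function.iterate_succ_apply']
      set R := (G.step α p)^[ℓ] ∅
      have hnew : ∀ i ∈ G.newRejections α p R, i ∈ T := by
        intro i hi
        by_contra hiT
        have : p i ≤ G.budget α R i := by simpa [newRejections] using hi
        exact (hno i hiT).not_ge (this.trans (budget_mono hT hα ih hiT))
      intro i hi
      simp only [step, Finset.mem_union, Finset.mem_filter, Finset.mem_univ, true_and] at hi
      rcases hi with (hi | hi) | ⟨j, hj, hij⟩
      · exact ih hi
      · exact hnew i hi
      · exact mem_of_transGen_adj hT hij (hnew j hj)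
  exact key _

/-- Control of the familywise error rate for p-values valid under the null hypotheses. -/
theorem measure_not_rejectedSet_subset_le {Ω : Type*} [MeasurableSpace Ω] (μ : Measure Ω)
    (G : PolyforestWeightedDAG I) (T : Finset I) (hT : ∀ i j, G.Adj i j → j ∈ T → i ∈ T)
    {α : ℝ} (hα : 0 ≤ α) (hα1 : α < 1) (p : Ω → I → ℝ)
    (hp : ∀ i ∉ T, ∀ t : ℝ, 0 ≤ t → t < 1 → μ {ω | p ω i ≤ t} ≤ ENNReal.ofReal t) :
    μ {ω | ¬ G.rejectedSet α (p ω) ⊆ T} ≤ ENNReal.ofReal α := by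
  classical
  have hle : ∀ i, G.budget α T i ≤ α := fun i =>
    (Finset.single_le_sum (fun j _ => G.budget_nonneg hα T j) (Finset.mem_univ i)).trans
      (sum_budget_le hT hα)
  calc μ {ω | ¬ G.rejectedSet α (p ω) ⊆ T}
      ≤ μ (⋃ i ∈ Tᶜ, {ω | p ω i ≤ G.budget α T i}) := by
        refine measure_mono fun ω hω => ?_
        obtain ⟨i, hi, h⟩ := exists_le_budget_of_not_subset hT hα hω
        simp only [Set.mem_iUnion]
        exact ⟨i, Finset.mem_compl.2 hi, h⟩
    _ ≤ ∑ i ∈ Tᶜ, μ {ω | p ω i ≤ G.budget α T i} := measure_biUnion_finset_le _ _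
    _ ≤ ∑ i ∈ Tᶜ, ENNReal.ofReal (G.budget α T i) := Finset.sum_le_sum fun i hi =>
        hp i (Finset.mem_compl.1 hi) _ (G.budget_nonneg hα T i) ((hle i).trans_lt hα1)
    _ ≤ ∑ i, ENNReal.ofReal (G.budget α T i) :=
        Finset.sum_le_sum_of_subset (Finset.subset_univ _)
    _ = ENNReal.ofReal (∑ i, G.budget α T i) :=
        (ENNReal.ofReal_sum_of_nonneg fun i _ => G.budget_nonneg hα T i).symm
    _ ≤ ENNReal.ofReal α := ENNReal.ofReal_le_ofReal (sum_budget_le hT hα)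

end ISS.PolyforestWeightedDAG

/-! ### Measurability of the selection event -/

/-- A function is measurable if it agrees with a measurable function on each fibre of a measurable
map to a countable discrete space. -/
theorem measurable_of_measurable_on_fibres {Ω C β : Type*} [MeasurableSpace Ω] [MeasurableSpace C]
    [MeasurableSpace β] [Countable C] [MeasurableSingletonClass C] {h : Ω → C} (hh : Measurable h)
    {f : Ω → β} (hf : ∀ ω₀, ∃ g : Ω → β, Measurable g ∧ ∀ ω, h ω = h ω₀ → f ω = g ω) :
    Measurable f := by
  choose g hg hfg using hf
  intro s hs
  have : f ⁻¹' s = ⋃ c : Set.range h, h ⁻¹' {(c : C)} ∩ g c.2.choose ⁻¹' s := by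
    ext ω
    simp only [Set.mem_iUnion, Set.mem_inter_iff, Set.mem_preimage, Set.mem_singleton_iff]
    have key : ∀ c : Set.range h, h ω = c → f ω = g c.2.choose ω := fun c hc =>
      hfg _ ω (hc.trans c.2.choose_spec.symm)
    constructor
    · intro hω
      refine ⟨⟨h ω, ω, rfl⟩, rfl, ?_⟩
      rwa [← key ⟨h ω, ω, rfl⟩ rfl]
    · rintro ⟨c, hc, hω⟩
      rwa [key c hc]
  rw [this]
  exact MeasurableSet.iUnion fun c => (hh (measurableSet_singleton _)).inter (hg _ hs)

theorem measurable_finset_inf' {Ω ι : Type*} [MeasurableSpace Ω] {s : Finset ι} (hs : s.Nonempty)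
    {f : ι → Ω → ℝ} (hf : ∀ k, Measurable (f k)) :
    Measurable fun ω => s.inf' hs fun k => f k ω := by
  have h : Measurable (s.inf' hs f) :=
    Finset.inf'_induction hs _ (fun _ h _ h' => h.inf h') fun k _ => hf k
  convert h using 1
  funext ω
  exact (Finset.inf'_apply hs f ω).symm

namespace ISS

namespace PolyforestWeightedDAG

variable {I : Type*} [Fintype I]

theorem rejectedSet_congr {G G' : PolyforestWeightedDAG I} (hA : G.Adj = G'.Adj)
    (hF : G.FAdj = G'.FAdj) (α : ℝ) (p : I → ℝ) : G.rejectedSet α p = G'.rejectedSet α p := by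
  have hL : ∀ R, G.unrejectedLeaves R = G'.unrejectedLeaves R := fun R => by
    ext i
    simp only [mem_unrejectedLeaves, hF]
  have hC : ∀ R, G.candidates R = G'.candidates R := fun R => by
    ext i
    simp only [mem_candidates, hF]
  have hb : ∀ R i, G.budget α R i = G'.budget α R i := fun R i => by
    simp only [budget, hL]
    rw [hF]
    by_cases h : i ∈ G'.candidates R
    · rw [if_pos h, if_pos (by rwa [hC])]
    · rw [if_neg h, if_neg (by rwa [hC])]
  have hN : ∀ R, G.newRejections α p R = G'.newRejections α p R := fun R => by
    ext i
    simp only [newRejections, Finset.mem_filter, hb]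
  have hs : G.step α p = G'.step α p := by
    funext R
    ext i
    simp only [step, Finset.mem_union, Finset.mem_filter, hN, hA]
  simp only [rejectedSet, hs]

theorem measurable_rejectedSet {Ω : Type*} [MeasurableSpace Ω] (G : PolyforestWeightedDAG I)
    (α : ℝ) {p : Ω → I → ℝ} (hp : Measurable p) :
    Measurable[_, ⊤] fun ω => G.rejectedSet α (p ω) := by
  let _ : MeasurableSpace (Finset I) := ⊤
  have hstep : ∀ R, Measurable fun ω => G.step α (p ω) R := by
    intro R
    -- One step depends on the p-values only through these finitely many comparisons.
    have hh : Measurable fun ω => fun i => p ω i ≤ G.budget α R i := by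
      refine measurable_pi_iff.2 fun i => measurableSet_setOfPred.1 ?_
      exact measurableSet_le ((measurable_pi_apply i).comp hp) measurable_const
    refine measurable_of_measurable_on_fibres hh fun ω₀ =>
      ⟨fun _ => G.step α (p ω₀) R, measurable_const, fun ω hω => ?_⟩
    have : G.newRejections α (p ω) R = G.newRejections α (p ω₀) R :=
      Finset.filter_congr fun i _ => iff_of_eq (congrFun hω i)
    ext i
    simp only [step, Finset.mem_union, Finset.mem_filter, this]
  have hiter : ∀ k, Measurable fun ω => (G.step α (p ω))^[k] ∅ := by
    intro k
    induction k with
    | zero => exact measurable_const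
    | succ k ih =>
      refine measurable_of_measurable_on_fibres ih fun ω₀ =>
        ⟨_, hstep ((G.step α (p ω₀))^[k] ∅), fun ω hω => ?_⟩
      rw [Function.iterate_succ_apply']
      exact congrArg _ hω
  exact hiter _

end PolyforestWeightedDAG

variable {n d m : ℕ}

theorem inducedGraph_fAdj (z : Fin m → Fin d → ℝ) :
    (inducedGraph z).FAdj = InducedForestEdge z := by
  funext i j
  refine propext ⟨fun h => ?_, fun h => ⟨h.1, if_pos h⟩⟩
  by_contra hne
  have h2 : (inducedGraph z).weight i j = 1 := h.2
  simp [inducedGraph, hne] at h2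

section Measurability

variable {Ω : Type*} [MeasurableSpace Ω]

theorem measurable_inducedEdge {z : Ω → Fin m → Fin d → ℝ} (hz : Measurable z) (i j : Fin m) :
    Measurable fun ω => InducedEdge (z ω) i j := by
  have hzi : ∀ i, Measurable fun ω => z ω i := measurable_pi_iff.1 hz
  have hle : ∀ a b, Measurable fun ω => z ω a ≤ z ω b := fun a b =>
    measurableSet_setOfPred.1 (measurableSet_le (hzi a) (hzi b))
  have heq : ∀ a b, Measurable fun ω => z ω a = z ω b := fun a b =>
    measurableSet_setOfPred.1 (measurableSet_eq_fun (hzi a) (hzi b))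
  unfold InducedEdge
  refine measurable_const.and ((hle j i).and (((heq j i).imp measurable_const).and ?_))
  refine Measurable.forall fun k => (hle j k).imp ((hle k i).imp ?_)
  exact ((heq k i).and measurable_const).or ((heq k j).and measurable_const)

theorem measurable_inducedForestEdge {z : Ω → Fin m → Fin d → ℝ} (hz : Measurable z)
    (i j : Fin m) : Measurable fun ω => InducedForestEdge (z ω) i j := by
  have hzi : ∀ i, Measurable fun ω => z ω i := measurable_pi_iff.1 hz
  have hn : ∀ a b, Measurable fun ω => ‖z ω a - z ω b‖ := fun a b => ((hzi a).sub (hzi b)).norm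
  unfold InducedForestEdge
  refine (measurable_inducedEdge hz i j).and (Measurable.forall fun k =>
    (measurable_inducedEdge hz k j).imp (Measurable.or ?_ (Measurable.and ?_ measurable_const)))
  · exact measurableSet_setOfPred.1 (measurableSet_lt (hn i j) (hn k j))
  · exact measurableSet_setOfPred.1 (measurableSet_eq_fun (hn i j) (hn k j))

theorem measurable_covariates :
    Measurable (covariates : (Fin n → (Fin d → ℝ) × ℝ) → Fin n → Fin d → ℝ) :=
  measurable_pi_iff.2 fun i => measurable_fst.comp (measurable_pi_apply i)

theorem measurable_pValue (σ τ : ℝ) (i : Fin n) :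
    Measurable fun D : Fin n → (Fin d → ℝ) × ℝ => pValue σ τ D (covariates D i) := by
  classical
  have hX : ∀ l, Measurable fun D : Fin n → (Fin d → ℝ) × ℝ => covariates D l :=
    measurable_pi_iff.1 measurable_covariates
  have hn : ∀ l, Measurable fun D : Fin n → (Fin d → ℝ) × ℝ =>
      ‖covariates D l - covariates D i‖ := fun l => ((hX l).sub (hX i)).norm
  -- Once the order and distance comparisons are fixed, the neighbour ordering is constant and the
  -- p-value is an explicit measurable formula in the responses.
  have hh : Measurable fun D : Fin n → (Fin d → ℝ) × ℝ =>
      ((fun l => covariates D l ≤ covariates D i : Fin n → Prop),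
        (fun l l' => ‖covariates D l - covariates D i‖ < ‖covariates D l' - covariates D i‖ ∨
          (‖covariates D l - covariates D i‖ = ‖covariates D l' - covariates D i‖ ∧ l ≤ l') :
          Fin n → Fin n → Prop)) := by
    refine Measurable.prodMk (measurable_pi_iff.2 fun l => ?_)
      (measurable_pi_iff.2 fun l => measurable_pi_iff.2 fun l' =>
        Measurable.or ?_ (Measurable.and ?_ measurable_const))
    · exact measurableSet_setOfPred.1 (measurableSet_le (hX l) (hX i))
    · exact measurableSet_setOfPred.1 (measurableSet_lt (hn l) (hn l'))
    · exact measurableSet_setOfPred.1 (measurableSet_eq_fun (hn l) (hn l'))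
  refine measurable_of_measurable_on_fibres hh fun D₀ => ?_
  set S := lowerIdx (covariates D₀) (covariates D₀ i) with hS
  set r := neighbourRank (covariates D₀) (covariates D₀ i) with hr
  refine ⟨fun D => if h : (Finset.Icc 1 S.card).Nonempty then
    min 1 ((Finset.Icc 1 S.card).inf' h fun k =>
      5.2 * Real.exp (-(max (∑ j ∈ S.filter (fun j => r j ≤ k), ((D j).2 - τ) / σ) 0) ^ 2
        / (2.0808 * (k : ℝ)) + Real.log (Real.log (2 * (k : ℝ))) / 0.72)) else 1, ?_, ?_⟩
  · split_ifs with h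
    · exact measurable_const.min (measurable_finset_inf' h fun k => by fun_prop)
    · exact measurable_const
  · intro D hD
    have h1 : lowerIdx (covariates D) (covariates D i) = S :=
      Finset.filter_congr fun l _ => iff_of_eq (congrFun (Prod.ext_iff.1 hD).1 l)
    have h2 : neighbourRank (covariates D) (covariates D i) = r := by
      funext l
      simp only [hr, neighbourRank, h1]
      refine congrArg Finset.card (Finset.filter_congr fun l' _ => ?_)
      exact iff_of_eq (congrFun (congrFun (Prod.ext_iff.1 hD).2 l') l)
    simp only [pValue, partialSum, h1, h2]

theorem measurable_rejectedIdx (hm : m ≤ n) (σ τ α : ℝ) :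
    Measurable[_, ⊤] (rejectedIdx hm σ τ α : (Fin n → (Fin d → ℝ) × ℝ) → Finset (Fin m)) := by
  let _ : MeasurableSpace (Finset (Fin m)) := ⊤
  have hz : Measurable fun (D : Fin n → (Fin d → ℝ) × ℝ) (i : Fin m) =>
      covariates D (Fin.castLE hm i) :=
    measurable_pi_iff.2 fun i => measurable_pi_iff.1 measurable_covariates _
  have hh := (measurable_pi_iff.2 fun i => measurable_pi_iff.2 fun j =>
    measurable_inducedEdge hz i j).prodMk (measurable_pi_iff.2 fun i => measurable_pi_iff.2 fun j =>
    measurable_inducedForestEdge hz i j)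
  refine measurable_of_measurable_on_fibres hh fun D₀ => ⟨_,
    (inducedGraph fun i : Fin m => covariates D₀ (Fin.castLE hm i)).measurable_rejectedSet α
      (measurable_pi_iff.2 fun i => measurable_pValue σ τ (Fin.castLE hm i)), fun D hD => ?_⟩
  refine PolyforestWeightedDAG.rejectedSet_congr (Prod.ext_iff.1 hD).1 ?_ _ _
  rw [inducedGraph_fAdj, inducedGraph_fAdj]
  exact (Prod.ext_iff.1 hD).2

end Measurability

theorem selectionSet_subset_iff (hm : m ≤ n) {σ τ α : ℝ} {η : (Fin d → ℝ) → ℝ} (hη : Monotone η)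
    (D : Fin n → (Fin d → ℝ) × ℝ) :
    selectionSet hm σ τ α D ⊆ superlevelSet τ η ↔
      ∀ i ∈ rejectedIdx hm σ τ α D, τ ≤ η (covariates D (Fin.castLE hm i)) :=
  ⟨fun h i hi => h ⟨i, hi, le_rfl⟩, fun h _ ⟨i, hi, hx⟩ => (h i hi).trans (hη hx)⟩

theorem measurableSet_selectionSet_subset (hm : m ≤ n) (σ τ α : ℝ) {η : (Fin d → ℝ) → ℝ}
    (hη : Monotone η) (hηm : Measurable η) :
    MeasurableSet {D : Fin n → (Fin d → ℝ) × ℝ |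
      selectionSet hm σ τ α D ⊆ superlevelSet τ η} := by
  simp only [selectionSet_subset_iff hm hη]
  refine measurableSet_setOfPred.2 (Measurable.forall fun i => Measurable.imp ?_ ?_)
  · exact measurableSet_setOfPred.1 (measurable_rejectedIdx hm σ τ α
      (show MeasurableSet[⊤] {R : Finset (Fin m) | i ∈ R} from trivial))
  · exact measurableSet_setOfPred.1 (measurableSet_le measurable_const
      (hηm.comp (measurable_pi_iff.1 measurable_covariates _)))

end ISS

/-! ### Disintegration of an i.i.d. sample -/

section Disintegration

variable {ι E F : Type*} [MeasurableSpace E] [MeasurableSpace F]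

theorem measurable_zip : Measurable fun (q : (ι → E) × (ι → F)) i => (q.1 i, q.2 i) := by
  fun_prop

variable [Fintype ι]

/-- Independent draws from `κ (x i)`, for `i` in a finite type. -/
noncomputable def piKernel (κ : Kernel E F) [IsMarkovKernel κ] : Kernel (ι → E) (ι → F) where
  toFun x := Measure.pi fun i => κ (x i)
  measurable' := by
    refine Measurable.measure_of_isPiSystem_of_isProbabilityMeasure generateFrom_pi.symm
      isPiSystem_pi ?_
    rintro _ ⟨s, hs, rfl⟩
    simp only [Measure.pi_pi]
    exact Finset.measurable_prod _ fun i _ =>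
      (κ.measurable_coe (hs i (Set.mem_univ i))).comp (measurable_pi_apply i)

theorem piKernel_apply (κ : Kernel E F) [IsMarkovKernel κ] (x : ι → E) :
    piKernel κ x = Measure.pi fun i => κ (x i) := rfl

instance (κ : Kernel E F) [IsMarkovKernel κ] : IsMarkovKernel (piKernel (ι := ι) κ) :=
  ⟨fun x => by rw [piKernel_apply]; infer_instance⟩

theorem lintegral_pi_prod (μ : ι → Measure E) [∀ i, IsProbabilityMeasure (μ i)]
    {f : ι → E → ℝ≥0∞} (hf : ∀ i, Measurable (f i)) :
    ∫⁻ x, ∏ i, f i (x i) ∂(Measure.pi μ) = ∏ i, ∫⁻ x, f i x ∂(μ i) := by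
  refine (lintegral_prod_eq_prod_lintegral_of_indepFun Finset.univ
    (fun i (x : ι → E) => f i (x i)) (iIndepFun_pi fun i => (hf i).aemeasurable)
    fun i => (hf i).comp (measurable_pi_apply i)).trans (Finset.prod_congr rfl fun i _ => ?_)
  exact (measurePreserving_eval μ i).lintegral_comp (hf i)

/-- A product of copies of `μ ⊗ₘ κ` is obtained by first drawing all the first components, and
then all the second components. -/
theorem pi_compProd_eq_map (μ : Measure E) [IsProbabilityMeasure μ] (κ : Kernel E F)
    [IsMarkovKernel κ] :
    Measure.pi (fun _ : ι => μ ⊗ₘ κ)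
      = (Measure.pi (fun _ : ι => μ) ⊗ₘ piKernel κ).map fun q i => (q.1 i, q.2 i) := by
  refine (Measure.pi_eq fun s hs => ?_)
  rw [Measure.map_apply measurable_zip (MeasurableSet.univ_pi hs),
    Measure.compProd_apply (measurable_zip (MeasurableSet.univ_pi hs))]
  have h : ∀ x : ι → E, piKernel κ x (Prod.mk x ⁻¹' ((fun (q : (ι → E) × (ι → F)) i =>
      (q.1 i, q.2 i)) ⁻¹' Set.univ.pi s)) = ∏ i, κ (x i) (Prod.mk (x i) ⁻¹' s i) := by
    intro x
    rw [piKernel_apply, ← Measure.pi_pi]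
    congr 1
  simp_rw [h]
  rw [lintegral_pi_prod (fun _ => μ) (f := fun i x => κ x (Prod.mk x ⁻¹' s i))
    fun i => Kernel.measurable_kernel_prodMk_left (hs i)]
  exact Finset.prod_congr rfl fun i _ => (Measure.compProd_apply (hs i)).symm

end Disintegration

/-! ### Conditional error bound and the theorem -/

namespace ISS

variable {n d m : ℕ}

theorem measure_not_selectionSet_subset_le (hm : m ≤ n) {α τ σ : ℝ} (hα0 : 0 ≤ α) (hα1 : α < 1)
    (hσ : 0 < σ) {η : (Fin d → ℝ) → ℝ} (hη : Monotone η) (X : Fin n → Fin d → ℝ)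
    (ν : Fin n → Measure ℝ) [∀ i, IsProbabilityMeasure (ν i)]
    (hν : ∀ i, HasSubgaussianMGF (fun y : ℝ => y - η (X i)) (⟨σ ^ 2, sq_nonneg σ⟩ : ℝ≥0) (ν i)) :
    Measure.pi ν {y | ¬ selectionSet hm σ τ α (fun i => (X i, y i)) ⊆ superlevelSet τ η}
      ≤ ENNReal.ofReal α := by
  classical
  -- The false null hypotheses; monotonicity of `η` along edges makes this set closed under
  -- ancestors.
  set T : Finset (Fin m) := Finset.univ.filter fun i => τ ≤ η (X (Fin.castLE hm i)) with hT
  refine le_trans (measure_mono fun y hy => ?_)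
    ((inducedGraph fun i : Fin m => X (Fin.castLE hm i)).measure_not_rejectedSet_subset_le
      (Measure.pi ν) T ?_ hα0 hα1
      (fun y i => pValue σ τ (fun j => (X j, y j)) (X (Fin.castLE hm i))) ?_)
  · rw [Set.mem_ofPred_eq, selectionSet_subset_iff hm hη] at hy
    refine fun hsub => hy fun i hi => ?_
    exact (Finset.mem_filter.1 (hsub hi)).2
  · intro i j hij hj
    rw [hT, Finset.mem_filter] at hj ⊢
    exact ⟨Finset.mem_univ _, hj.2.trans (hη hij.2.1)⟩
  · intro i hi t ht0 ht1
    refine measure_pValue_le hσ X _ ν (fun j => η (X j)) hν (fun j hj => ?_) ht0 ht1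
    have : η (X (Fin.castLE hm i)) < τ := by simpa [hT] using hi
    exact (hη hj).trans this.le

theorem pi_inter_covariates_preimage_le (hm : m ≤ n) {α τ σ : ℝ} (hα0 : 0 ≤ α) (hα1 : α < 1)
    (hσ : 0 < σ) (P : Measure ((Fin d → ℝ) × ℝ)) [IsProbabilityMeasure P]
    {η : (Fin d → ℝ) → ℝ} (hP : IsMonotoneSubGaussian σ P η) {B : Set (Fin n → Fin d → ℝ)}
    (hB : MeasurableSet B) :
    Measure.pi (fun _ : Fin n => P)
        ({D | selectionSet hm σ τ α D ⊆ superlevelSet τ η}ᶜ ∩ covariates ⁻¹' B)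
      ≤ ENNReal.ofReal α * Measure.pi (fun _ : Fin n => P) (covariates ⁻¹' B) := by
  have hA := (measurableSet_selectionSet_subset (n := n) hm σ τ α hP.monotone
    hP.regression.measurable).compl
  have hBm : MeasurableSet (covariates ⁻¹' B : Set (Fin n → (Fin d → ℝ) × ℝ)) :=
    measurable_covariates hB
  have hdis : Measure.pi (fun _ : Fin n => P)
      = (Measure.pi (fun _ : Fin n => P.fst) ⊗ₘ piKernel P.condKernel).map
        fun q i => (q.1 i, q.2 i) := by
    rw [← pi_compProd_eq_map, P.disintegrate P.condKernel]
  have hgood : ∀ᵐ x ∂(Measure.pi fun _ : Fin n => P.fst), ∀ i, HasSubgaussianMGF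
      (fun y : ℝ => y - η (x i)) (⟨σ ^ 2, sq_nonneg σ⟩ : ℝ≥0) (P.condKernel (x i)) := by
    rw [ae_all_iff]
    exact fun i => (Measure.quasiMeasurePreserving_eval (μ := fun _ : Fin n => P.fst) i).ae
      hP.subGaussian
  rw [hdis, Measure.map_apply measurable_zip (hA.inter hBm), Measure.map_apply measurable_zip hBm,
    Measure.compProd_apply (measurable_zip (hA.inter hBm)),
    Measure.compProd_apply (measurable_zip hBm), ← lintegral_const_mul' _ _ ENNReal.ofReal_ne_top]
  refine lintegral_mono_ae (hgood.mono fun x hx => ?_)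
  -- The covariate event is decided by `x`: its fibre is everything or nothing.
  by_cases hxB : x ∈ B
  · have h1 : (Prod.mk x ⁻¹' ((fun (q : (Fin n → Fin d → ℝ) × (Fin n → ℝ)) i =>
        (q.1 i, q.2 i)) ⁻¹' (covariates ⁻¹' B))) = Set.univ :=
      Set.eq_univ_of_forall fun y => hxB
    rw [h1, measure_univ, mul_one, piKernel_apply]
    exact (measure_mono fun y hy => hy.1).trans
      (measure_not_selectionSet_subset_le hm hα0 hα1 hσ hP.monotone x _ hx)
  · refine le_of_eq_of_le (measure_mono_null (fun y hy => hxB hy.2) measure_empty) zero_le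

end ISS

/-- An inequality between `m`-measurable functions may be tested by integrating over sets of `m`;
trimming `μ` to `m` makes those the only sets to check. -/
theorem const_le_condExp_indicator {Ω : Type*} {m m₀ : MeasurableSpace Ω} {μ : Measure Ω}
    [IsProbabilityMeasure μ] (hm : m ≤ m₀) {A : Set Ω} (hA : MeasurableSet[m₀] A) {α : ℝ}
    (hα : 0 ≤ α)
    (h : ∀ B, MeasurableSet[m] B → μ (Aᶜ ∩ B) ≤ ENNReal.ofReal α * μ B) :
    ∀ᵐ ω ∂μ, 1 - α ≤ (μ⟦A | m⟧) ω := by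
  have hint : Integrable (A.indicator fun _ => (1 : ℝ)) μ :=
    (integrable_const 1).indicator hA
  refine ae_le_of_ae_le_trim (hm := hm) (f₁ := fun _ => 1 - α) ?_
  refine ae_le_of_forall_setIntegral_le (integrable_const _)
    (integrable_condExp.trim hm stronglyMeasurable_condExp) fun B hB _ => ?_
  rw [← setIntegral_trim hm stronglyMeasurable_condExp hB, setIntegral_condExp hm hint hB,
    setIntegral_indicator hA, setIntegral_const, setIntegral_const, smul_eq_mul, smul_eq_mul,
    mul_one, measureReal_def, trim_measurableSet_eq hm hB, ← measureReal_def]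
  have h1 : μ.real (Aᶜ ∩ B) ≤ α * μ.real B := by
    have := ENNReal.toReal_mono (ENNReal.mul_ne_top ENNReal.ofReal_ne_top (measure_ne_top μ B))
      (h B hB)
    rwa [ENNReal.toReal_mul, ENNReal.toReal_ofReal hα] at this
  have h2 := measureReal_inter_add_sdiff (μ := μ) (s := B) hA
  have h3 : B \ A = Aᶜ ∩ B := by rw [Set.sdiff_eq, Set.inter_comm]
  rw [h3] at h2
  linarith

theorem theorem1 {d n m : ℕ} (hm : m ≤ n) {α τ σ : ℝ} (hα0 : 0 < α) (hα1 : α < 1) (hσ : 0 < σ)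
    (P : Measure ((Fin d → ℝ) × ℝ)) [IsProbabilityMeasure P] (η : (Fin d → ℝ) → ℝ)
    (hP : ISS.IsMonotoneSubGaussian σ P η)
    {Ω : Type*} [MeasurableSpace Ω] (Pr : Measure Ω) [IsProbabilityMeasure Pr]
    (D : Ω → Fin n → (Fin d → ℝ) × ℝ) (hD : Measurable D)
    (hlaw : Pr.map D = Measure.pi fun _ : Fin n => P) :
    ∀ᵐ ω ∂Pr, 1 - α ≤
      (Pr⟦{ω | ISS.selectionSet hm σ τ α (D ω) ⊆ ISS.superlevelSet τ η} |
        MeasurableSpace.comap (fun ω => ISS.covariates (D ω)) inferInstance⟧) ω := by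
  have hA := ISS.measurableSet_selectionSet_subset (n := n) hm σ τ α hP.monotone
    hP.regression.measurable
  refine const_le_condExp_indicator (ISS.measurable_covariates.comp hD).comap_le (hD hA) hα0.le ?_
  rintro _ ⟨B, hB, rfl⟩
  have hBm : MeasurableSet (ISS.covariates ⁻¹' B : Set (Fin n → (Fin d → ℝ) × ℝ)) :=
    ISS.measurable_covariates hB
  have h := ISS.pi_inter_covariates_preimage_le hm hα0.le hα1 hσ P (τ := τ) hP hB
  rw [← hlaw] at h
  rw [Measure.map_apply hD (hA.compl.inter hBm), Measure.map_apply hD hBm] at h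
  exact h
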